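/- **Setting.** Let $I=\{1,2\}$, $\bar 1=2$, $\bar 2=1$. For $\iota\in I$ let $H_\iota$ be a complex Hilbert space with a distinguished unit vector $\xi_\iota$, put $H_\iota^0=H_\iota\ominus\mathbb C\xi_\iota$, and let $$\mathcal H=\mathbb C\xi\oplus\bigoplus_{n\ge 1}\ \bigoplus_{\iota_1\ne\iota_2\ne\dots\ne\iota_n}H^0_{\iota_1}\otimes\dots\otimes H^0_{\iota_n}$$ be their Hilbert space free product, with unit vacuum vector $\xi$. For $n\ge1$ let $\mathcal H^{(n)}(\iota)$ be the sum of the tensor products of order $n$ with $\iota_1\ne\iota$, and put $\mathcal H^{(0)}(\iota)=\mathbb C\xi$. For $n\ge 1$ let $P_\iota(n)$ be the orthogonal projection of $\mathcal H$ onto $\mathcal H^{(n-1)}(\iota)\oplus\mathcal H^{(n)}(\bar\iota)$, and let $$\mathcal K_\iota=\bigoplus_{n\ \mathrm{odd}}\bigl(\mathcal H^{(n-1)}(\iota)\oplus\mathcal H^{(n)}(\bar\iota)\bigr)\subset\mathcal H .$$ Let $a_\iota\in B(H_\iota)$, $\iota\in I$, be arbitrary bounded operators. Let $X_\iota=\lambda(a_\iota)\in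 B(\mathcal H)$, where $\lambda$ is the free product representation: $X_\iota=V_\iota(a_\iota\otimes 1)V_\iota^{-1}$ with the unitary $V_\iota:H_\iota\otimes\bigoplus_{n\ge0}\mathcal H^{(n)}(\iota)\to\mathcal H$, $V_\iota(h\otimes f)=\langle h,\xi_\iota\rangle f+h^0\otimes f$, where $h^0$ is the projection of $h$ onto $H_\iota^0$ and $h^0\otimes\xi$ is identified with $h^0$. Put $x_\iota(j)=P_\iota(j)X_\iota P_\iota(j)-P_\iota(j)$ for $j\ge1$, and define the following operators on $\mathcal K_\iota$ (series in the strong operator topology, with summands restricted to $\mathcal K_\iota$): $$R_\iota^{\mathrm{odd}}=1+\sum_{j\ \mathrm{odd}}x_\iota(j),\qquad R_{\bar\iota}^{\mathrm{even}}=1+\sum_{j\ge 2\ \mathrm{even}}x_{\bar\iota}(j).$$ Here $1=1_{\mathcal K_\iota}$. Let $P_\xi$ be the projection of $\mathcal K_\iota$ onto $\mathbb C\xi$. **s-freeness.** Let $\mathcal A$ be a unital complex algebra with linear functionals $\varphi,\psi$ such that $\varphi(1)=\psi(1)=1$. Let $\mathcal A_1\subset\mathcal A$ be a unital subalgebra and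 $\mathcal A_2\subset\mathcal A$ a not necessarily unital subalgebra with an internal unit $1_2\in\mathcal A_2$, i.e. $1_2b=b=b1_2$ for all $b\in\mathcal A_2$. Put $\mathcal A_1^0=\mathcal A_1\cap\ker\varphi$ and $\mathcal A_2^0=\mathcal A_2\cap\ker\psi$. The pair $(\mathcal A_1,\mathcal A_2)$ is *s-free* with respect to $(\varphi,\psi)$ if $\psi(1_2)=1$ and 1. $\varphi(b_1b_2\cdots b_n)=0$ whenever $n\ge1$, $b_k\in\mathcal A^0_{i_k}$ and $i_1\neq i_2\neq\dots\neq i_n$; 2. $\varphi(w_11_2w_2)=\varphi(w_1w_2)-\varphi(w_1)\varphi(w_2)$ for all $w_1,w_2\in\mathrm{alg}(\mathcal A_1,\mathcal A_2)$. A pair $(a,b)$ of elements of $\mathcal A$ is *s-free* with respect to $(\varphi,\psi)$, with internal unit $1_2\in\mathcal A$ of the second variable, if $(\mathrm{alg}(1,a),\mathrm{alg}(1_2,b))$ is s-free with respect to $(\varphi,\psi)$, with internal unit $1_2$; it is *s-free* if this holds for some $1_2\in\mathcal A$. **Proposition 8.2.** Let $\iota\in I$, let $\zeta\in H_\iota^0\subset\mathcal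 K_\iota$ be any unit vector, and let $\varphi(a)=\langle a\xi,\xi\rangle$ and $\psi(a)=\langle a\zeta,\zeta\rangle$ for $a\in\mathcal A=B(\mathcal K_\iota)$. Then the pair $$\bigl(R_\iota^{\mathrm{odd}}-1,\ R_{\bar\iota}^{\mathrm{even}}-1\bigr)$$ is s-free with respect to $(\varphi,\psi)$, and the internal unit of the second variable can be taken to be $1_2=1-P_\xi$. -/

import Mathlib

universe u

set_option maxSynthPendingDepth 3

namespace FreeProd

open scoped TensorProduct
open UniformSpace

noncomputable section

/-- A complex Hilbert space, as a bundled object. -/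
structure HilbSpace : Type (u + 1) where
  carrier : Type u
  [normed : NormedAddCommGroup carrier]
  [innerProduct : InnerProductSpace ℂ carrier]
  [complete : CompleteSpace carrier]

attribute [instance] HilbSpace.normed HilbSpace.innerProduct HilbSpace.complete

instance : CoeSort HilbSpace.{u} (Type u) := ⟨HilbSpace.carrier⟩

/-- A complex Hilbert space with a distinguished unit vector. -/
structure PointedHilbertSpace : Type (u + 1) extends HilbSpace.{u} where
  vec : carrier
  norm_vec : ‖vec‖ = 1

instance : CoeSort PointedHilbertSpace.{u} (Type u) := ⟨fun H => H.carrier⟩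

/-- `H⁰ = H ⊖ ℂ ξ`. -/
abbrev PointedHilbertSpace.compl (H : PointedHilbertSpace.{u}) : Submodule ℂ H :=
  (ℂ ∙ H.vec)ᗮ

variable (H : Fin 2 → PointedHilbertSpace.{u})

/-- The Hilbert space tensor product `H⁰_{i₁} ⊗ ⋯ ⊗ H⁰_{iₙ}` attached to the word `[i₁, …, iₙ]`:
one-dimensional for the empty word, and for `i :: w` the completion of the algebraic tensor product
of `H⁰_i` with the space of `w`, with its tensor product inner product. -/
def wordSpace : List (Fin 2) → HilbSpace.{u}
  | [] => ⟨EuclideanSpace ℂ PUnit.{u + 1}⟩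
  | i :: w => ⟨Completion ((H i).compl ⊗[ℂ] (wordSpace w))⟩

/-- Alternating words in the two letters `0, 1`, that is, `i₁ ≠ i₂ ≠ ⋯ ≠ iₙ`. The empty word is
included. -/
abbrev Word : Type := {w : List (Fin 2) // w.IsChain (· ≠ ·)}

/-- The Hilbert space free product: the Hilbert direct sum, over all alternating words, of the
corresponding tensor products. The empty word contributes the vacuum line `ℂ ξ`. -/
abbrev FreeFock : Type u := lp (fun w : Word => wordSpace H w.1) 2


/-- The canonical isometry `H⁰_i ⊗ (algebraic) T_w → T_{i :: w}`. -/
def wordTensor (i : Fin 2) (w : List (Fin 2)) :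
    ((H i).compl ⊗[ℂ] (wordSpace H w)) →ₗᵢ[ℂ] wordSpace H (i :: w) :=
  Completion.toComplₗᵢ

theorem denseRange_wordTensor (i : Fin 2) (w : List (Fin 2)) :
    DenseRange (wordTensor H i w) :=
  Completion.denseRange_coe

theorem norm_wordTensor_tmul {i : Fin 2} {w : List (Fin 2)} (h : (H i).compl)
    (v : wordSpace H w) : ‖wordTensor H i w (h ⊗ₜ[ℂ] v)‖ = ‖h‖ * ‖v‖ := by
  rw [LinearIsometry.norm_map, TensorProduct.norm_tmul]

theorem inner_wordTensor_tmul {i : Fin 2} {w : List (Fin 2)} (h h' : (H i).compl)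
    (v v' : wordSpace H w) :
    inner ℂ (wordTensor H i w (h ⊗ₜ[ℂ] v)) (wordTensor H i w (h' ⊗ₜ[ℂ] v')) =
      inner ℂ h h' * inner ℂ v v' := by
  rw [LinearIsometry.inner_map_map, TensorProduct.inner_tmul]

/-- Coordinates of the creation operator: the `(ι :: w)`-coordinate of the result is `h ⊗ f_w`,
all coordinates at words not starting with `ι` vanish. -/
def createFun {ι : Fin 2} (h : (H ι).compl) (f : (w : Word) → wordSpace H w.1) :
    (w : Word) → wordSpace H w.1
  | ⟨[], _⟩ => 0
  | ⟨i :: w, hw⟩ =>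
      wordTensor H i w ((Pi.single ι h : (j : Fin 2) → (H j).compl) i ⊗ₜ[ℂ] f ⟨w, hw.tail⟩)

/-- Alternating words that do not start with `ι`. -/
def Word.avoid (ι : Fin 2) : Set Word := {w | w.1.head? ≠ some ι}

/-- Put the letter `ι` in front of a word that does not start with `ι`. -/
abbrev Word.cons (ι : Fin 2) (w : Word.avoid ι) : Word :=
  ⟨ι :: w.1.1, List.isChain_cons.2
    ⟨fun i hi hι => w.2 (hι ▸ hi), w.1.2⟩⟩

theorem Word.cons_injective (ι : Fin 2) : Function.Injective (Word.cons ι) := by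
  intro a b h
  have := congrArg Subtype.val h
  simp only [List.cons.injEq, true_and] at this
  exact Subtype.ext (Subtype.ext this)

variable {H}

theorem createFun_cons {ι : Fin 2} (h : (H ι).compl) (f : (w : Word) → wordSpace H w.1)
    (w : Word.avoid ι) :
    createFun H h f (Word.cons ι w) =
      wordTensor H ι w.1.1 (h ⊗ₜ[ℂ] f w.1) := by
  simp only [createFun, Word.cons, Pi.single_eq_same]

theorem createFun_eq_zero {ι : Fin 2} (h : (H ι).compl) (f : (w : Word) → wordSpace H w.1)
    (w : Word) (hw : w ∉ Set.range (Word.cons ι)) : createFun H h f w = 0 := by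
  match w, hw with
  | ⟨[], _⟩, _ => rfl
  | ⟨i :: w, hc⟩, hw =>
    have hi : i ≠ ι := by
      rintro rfl
      exact hw ⟨⟨⟨w, hc.tail⟩, fun h' => (List.isChain_cons.1 hc).1 i h' rfl⟩, rfl⟩
    simp only [createFun, Pi.single_eq_of_ne hi, TensorProduct.zero_tmul, map_zero]

theorem memlp_createFun {ι : Fin 2} (h : (H ι).compl) (f : FreeFock H) :
    Memℓp (createFun H h f) 2 := by
  refine memℓp_gen ?_
  refine ((Word.cons_injective ι).summable_iff ?_).1 ?_
  · intro w hw
    rw [createFun_eq_zero h _ w hw]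
    simp
  · have hf := ((lp.memℓp f).summable (by norm_num)).comp_injective
      (Subtype.val_injective (p := fun w => w ∈ Word.avoid ι))
    refine (hf.mul_left (‖h‖ ^ (2 : ENNReal).toReal)).congr fun w => ?_
    simp only [Function.comp_apply]
    rw [createFun_cons, norm_wordTensor_tmul, Real.mul_rpow (norm_nonneg _) (norm_nonneg _)]

/-- The left creation operator `f ↦ h ⊗ f` for `h ∈ H⁰_ι`; it vanishes on tensors starting in `H⁰_ι`. -/
def create {ι : Fin 2} (h : (H ι).compl) (f : FreeFock H) : FreeFock H :=
  ⟨createFun H h f, memlp_createFun h f⟩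

theorem create_ext {ι : Fin 2} {a b : FreeFock H}
    (h0 : ∀ w, w ∉ Set.range (Word.cons ι) → a w = b w)
    (h1 : ∀ w : Word.avoid ι, a (Word.cons ι w) = b (Word.cons ι w)) : a = b := by
  ext w
  by_cases hw : w ∈ Set.range (Word.cons ι)
  · obtain ⟨v, rfl⟩ := hw
    exact h1 v
  · exact h0 w hw

theorem create_cons {ι : Fin 2} (h : (H ι).compl) (f : FreeFock H) (w : Word.avoid ι) :
    create h f (Word.cons ι w) =
      wordTensor H ι w.1.1 (h ⊗ₜ[ℂ] f w.1) :=
  createFun_cons h f w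

theorem create_eq_zero {ι : Fin 2} (h : (H ι).compl) (f : FreeFock H)
    (w : Word) (hw : w ∉ Set.range (Word.cons ι)) : create h f w = 0 :=
  createFun_eq_zero h f w hw

/-- The left creation operator as a bilinear map. -/
def createₗ (ι : Fin 2) : (H ι).compl →ₗ[ℂ] FreeFock H →ₗ[ℂ] FreeFock H :=
  LinearMap.mk₂ ℂ create
    (fun h h' f => by
      refine create_ext (ι := ι) (fun w hw => ?_) fun w => ?_
      · rw [lp.coeFn_add, Pi.add_apply]; simp only [create_eq_zero _ _ w hw, add_zero]
      · rw [lp.coeFn_add, Pi.add_apply]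
        simp only [create_cons, TensorProduct.add_tmul, map_add])
    (fun c h f => by
      refine create_ext (ι := ι) (fun w hw => ?_) fun w => ?_
      · rw [lp.coeFn_smul, Pi.smul_apply]; simp only [create_eq_zero _ _ w hw, smul_zero]
      · rw [lp.coeFn_smul, Pi.smul_apply]
        simp only [create_cons, ← TensorProduct.smul_tmul', map_smul])
    (fun h f f' => by
      refine create_ext (ι := ι) (fun w hw => ?_) fun w => ?_
      · rw [lp.coeFn_add, Pi.add_apply]; simp only [create_eq_zero _ _ w hw, add_zero]
      · rw [lp.coeFn_add, Pi.add_apply]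
        simp only [create_cons, lp.coeFn_add, Pi.add_apply, TensorProduct.tmul_add, map_add])
    (fun c h f => by
      refine create_ext (ι := ι) (fun w hw => ?_) fun w => ?_
      · rw [lp.coeFn_smul, Pi.smul_apply]; simp only [create_eq_zero _ _ w hw, smul_zero]
      · rw [lp.coeFn_smul, Pi.smul_apply]
        simp only [create_cons, lp.coeFn_smul, Pi.smul_apply, TensorProduct.tmul_smul, map_smul])

/-- The closed subspace of `FreeFock H` which is the Hilbert direct sum of the tensor products attached
to the words in `S`. -/
def supported (H : Fin 2 → PointedHilbertSpace.{u}) (S : Set Word) : Submodule ℂ (FreeFock H) where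
  carrier := {f | ∀ w, w ∉ S → f w = 0}
  add_mem' := by
    intro a b ha hb w hw
    rw [lp.coeFn_add, Pi.add_apply, ha w hw, hb w hw, add_zero]
  zero_mem' := fun w _ => by rw [lp.coeFn_zero, Pi.zero_apply]
  smul_mem' := by
    intro c a ha w hw
    rw [lp.coeFn_smul, Pi.smul_apply, ha w hw, smul_zero]

theorem isClosed_supported (S : Set Word) : IsClosed (supported H S : Set (FreeFock H)) := by
  have : (supported H S : Set (FreeFock H)) =
      ⋂ w : Word, ⋂ _ : w ∉ S, {f : FreeFock H | f w = 0} := by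
    ext f; simp [supported]
  rw [this]
  refine isClosed_iInter fun w => isClosed_iInter fun _ => isClosed_eq ?_ continuous_const
  exact (lp.evalCLM ℂ (fun w : Word => (wordSpace H w.1 : Type u)) 2 w).continuous

instance (S : Set Word) : CompleteSpace (supported H S) :=
  (isClosed_supported S).completeSpace_coe

theorem inner_create_create {ι : Fin 2} (h h' : (H ι).compl) (f f' : supported H (Word.avoid ι)) :
    inner ℂ (create h f.1) (create h' f'.1) = inner ℂ h h' * inner ℂ f f' := by
  have e : inner ℂ f f' = inner ℂ (f : FreeFock H) (f' : FreeFock H) := rfl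
  rw [e, lp.inner_eq_tsum, lp.inner_eq_tsum,
    ← (Word.cons_injective ι).tsum_eq, ← tsum_subtype_eq_of_support_subset (s := Word.avoid ι),
    ← tsum_mul_left]
  · refine tsum_congr fun w => ?_
    rw [create_cons, create_cons]
    exact inner_wordTensor_tmul _ _ _ _ _
  · intro w hw
    by_contra h0
    exact hw (by simp only [f.2 w h0, inner_zero_left])
  · intro w hw
    by_contra h0
    exact hw (by simp only [create_eq_zero _ _ w h0, inner_zero_left])

theorem inner_create_right {ι : Fin 2} (h : (H ι).compl) (f : FreeFock H)
    (g : supported H (Word.avoid ι)) : inner ℂ (create h f) g.1 = 0 := by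
  rw [lp.inner_eq_tsum, ← tsum_zero (α := ℂ) (β := Word)]
  refine tsum_congr fun w => ?_
  by_cases hw : w ∈ Set.range (Word.cons ι)
  · obtain ⟨v, rfl⟩ := hw
    rw [g.2 _ (by simp [Word.avoid, Word.cons]), inner_zero_right]
  · rw [create_eq_zero _ _ w hw, inner_zero_left]

theorem vec_decomp (H : PointedHilbertSpace.{u}) (h : H) :
    h = inner ℂ H.vec h • H.vec + (H.compl.orthogonalProjectionOnto h : H) := by
  have h1 := Submodule.starProjection_add_starProjection_orthogonal (K := ℂ ∙ H.vec) h
  rw [Submodule.starProjection_unit_singleton ℂ H.norm_vec] at h1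
  exact h1.symm

theorem inner_decomp (H : PointedHilbertSpace.{u}) (h h' : H) :
    inner ℂ h h' = inner ℂ h H.vec * inner ℂ H.vec h' +
      inner ℂ (H.compl.orthogonalProjectionOnto h) (H.compl.orthogonalProjectionOnto h') := by
  have e : ∀ p q : H.compl, inner ℂ p q = inner ℂ (p : H) (q : H) := fun _ _ => rfl
  have o : ∀ p : H.compl, inner ℂ H.vec (p : H) = 0 := fun p =>
    Submodule.mem_orthogonal_singleton_iff_inner_right.1 p.2
  have o' : ∀ p : H.compl, inner ℂ (p : H) H.vec = 0 := fun p =>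
    Submodule.mem_orthogonal_singleton_iff_inner_left.1 p.2
  conv_lhs => rw [vec_decomp H h, vec_decomp H h']
  simp only [inner_add_left, inner_add_right, inner_smul_left, inner_smul_right, o, o',
    inner_self_eq_norm_sq_to_K, H.norm_vec, inner_conj_symm, e,
    RCLike.ofReal_one, one_pow, mul_zero, add_zero, zero_add, mul_one]
  ring

variable (H) in
/-- The linear map underlying `leftTensor`. -/
def leftTensorₗ (ι : Fin 2) : (H ι ⊗[ℂ] supported H (Word.avoid ι)) →ₗ[ℂ] FreeFock H :=
  TensorProduct.lift (LinearMap.mk₂ ℂ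
    (fun (h : H ι) (f : supported H (Word.avoid ι)) =>
      inner ℂ (H ι).vec h • (f : FreeFock H) +
        createₗ ι ((H ι).compl.orthogonalProjectionOnto h) f)
    (fun h h' f => by
      simp only [inner_add_right, map_add, LinearMap.add_apply, add_smul]; abel)
    (fun c h f => by
      simp only [inner_smul_right, map_smul, LinearMap.smul_apply, mul_smul, smul_add])
    (fun h f f' => by
      simp only [Submodule.coe_add, map_add, smul_add]; abel)
    (fun c h f => by
      simp only [Submodule.coe_smul, map_smul, smul_add]
      rw [smul_comm]))

theorem leftTensorₗ_tmul (ι : Fin 2) (h : H ι) (f : supported H (Word.avoid ι)) :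
    leftTensorₗ H ι (h ⊗ₜ[ℂ] f) = inner ℂ (H ι).vec h • (f : FreeFock H) +
        create ((H ι).compl.orthogonalProjectionOnto h) f := rfl

variable (H) in
/-- The isometry `V` from the algebraic tensor product of `H_ι` with the subspace of the free product
spanned by the words not starting with `ι` (vacuum included), into the free product:
`V (h ⊗ f) = ⟪ξ_ι, h⟫ f + h⁰ ⊗ f` with `h⁰` the projection of `h` on `H⁰_ι`. Its range is dense
(`denseRange_leftTensor`), so it extends to a unitary operator. -/
def leftTensor (ι : Fin 2) : (H ι ⊗[ℂ] supported H (Word.avoid ι)) →ₗᵢ[ℂ] FreeFock H :=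
  (leftTensorₗ H ι).isometryOfInner fun x y => by
    induction x with
    | zero => simp
    | add x x' hx hx' => simp only [map_add, inner_add_left, hx, hx']
    | tmul h f =>
      induction y with
      | zero => simp
      | add y y' hy hy' => simp only [map_add, inner_add_right, hy, hy']
      | tmul h' f' =>
        rw [leftTensorₗ_tmul, leftTensorₗ_tmul, TensorProduct.inner_tmul]
        have o := inner_create_right ((H ι).compl.orthogonalProjectionOnto h) f f'
        have o' : inner ℂ (f : FreeFock H)
            (create ((H ι).compl.orthogonalProjectionOnto h') f' : FreeFock H) = 0 := by
          rw [← inner_conj_symm, inner_create_right, map_zero]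
        have e : inner ℂ f f' = inner ℂ (f : FreeFock H) (f' : FreeFock H) := rfl
        simp only [inner_add_left, inner_add_right, inner_smul_left, inner_smul_right, o, o',
          inner_create_create, inner_decomp (H ι) h h', inner_conj_symm, e]
        ring

theorem leftTensor_tmul (ι : Fin 2) (h : H ι) (f : supported H (Word.avoid ι)) :
    leftTensor H ι (h ⊗ₜ[ℂ] f) = inner ℂ (H ι).vec h • (f : FreeFock H) +
        create ((H ι).compl.orthogonalProjectionOnto h) f := rfl

theorem single_mem_supported {S : Set Word} {w : Word} (hw : w ∈ S) (v : wordSpace H w.1) :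
    (lp.single 2 w v : FreeFock H) ∈ supported H S := by
  intro w' hw'
  rw [lp.single_apply_ne]
  rintro rfl
  exact hw' hw

theorem create_single {ι : Fin 2} (h : (H ι).compl) (w : Word.avoid ι) (v : wordSpace H w.1.1) :
    create h (lp.single 2 w.1 v : FreeFock H) =
      lp.single 2 (Word.cons ι w) (wordTensor H ι w.1.1 (h ⊗ₜ[ℂ] v)) := by
  refine create_ext (ι := ι) (fun w' hw' => ?_) fun w' => ?_
  · rw [create_eq_zero _ _ _ hw', lp.single_apply_ne]
    rintro rfl
    exact hw' ⟨w, rfl⟩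
  · rw [create_cons]
    by_cases e : w' = w
    · subst e
      rw [lp.single_apply_self, lp.single_apply_self]
    · rw [lp.single_apply_ne _ _ _ fun h' => e (Subtype.ext h'),
        lp.single_apply_ne _ _ _ fun h' => e (Word.cons_injective ι h'), TensorProduct.tmul_zero,
        map_zero]

theorem denseRange_leftTensor (ι : Fin 2) : DenseRange (leftTensor H ι) := by
  let M : Submodule ℂ (FreeFock H) := (LinearMap.range (leftTensorₗ H ι)).topologicalClosure
  have hM : IsClosed (M : Set (FreeFock H)) := Submodule.isClosed_topologicalClosure _
  have hmem : ∀ t, leftTensorₗ H ι t ∈ M := fun t =>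
    Submodule.le_topologicalClosure _ (LinearMap.mem_range_self _ t)
  have hs : ∀ (w : Word) (a : wordSpace H w.1), (lp.single 2 w a : FreeFock H) ∈ M := by
    intro w a
    by_cases hw : w ∈ Set.range (Word.cons ι)
    · obtain ⟨v, rfl⟩ := hw
      have hcl : IsClosed {a : wordSpace H (ι :: v.1.1) |
          (lp.single 2 (Word.cons ι v) a : FreeFock H) ∈ M} :=
        hM.preimage (lp.singleContinuousLinearMap ℂ
          (fun w : Word => (wordSpace H w.1 : Type u)) 2 (Word.cons ι v)).continuous
      refine (denseRange_wordTensor H ι v.1.1).induction_on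
        (p := fun a => (lp.single 2 (Word.cons ι v) a : FreeFock H) ∈ M) a hcl fun t => ?_
      induction t with
      | zero => rw [map_zero, lp.single_zero]; exact M.zero_mem
      | add t t' ht ht' => rw [map_add, lp.single_add]; exact M.add_mem ht ht'
      | tmul h x =>
        have := hmem ((h : H ι) ⊗ₜ[ℂ] ⟨lp.single 2 v.1 x, single_mem_supported v.2 x⟩)
        rw [leftTensorₗ_tmul, Submodule.orthogonalProjectionOnto_mem_subspace_eq_self,
          Submodule.mem_orthogonal_singleton_iff_inner_right.1 h.2, zero_smul, zero_add,
          create_single] at this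
        exact this
    · have hw' : w ∈ Word.avoid ι := by
        intro h
        obtain ⟨l, hl⟩ := w
        cases l with
        | nil => simp at h
        | cons i l =>
          obtain rfl : i = ι := by simpa using h
          exact hw ⟨⟨⟨l, hl.tail⟩, fun h' => (List.isChain_cons.1 hl).1 i h' rfl⟩, rfl⟩
      have := hmem ((H ι).vec ⊗ₜ[ℂ] ⟨lp.single 2 w a, single_mem_supported hw' a⟩)
      have h0 : (H ι).compl.orthogonalProjectionOnto (H ι).vec = 0 :=
        Submodule.orthogonalProjectionOnto_orthogonal_apply_eq_zero
          (Submodule.mem_span_singleton_self _)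
      have h1 : ∀ f : FreeFock H, create (0 : (H ι).compl) f = 0 := fun f => by
        have := congrArg (fun T => T f) (map_zero (createₗ (H := H) ι))
        exact this
      rw [leftTensorₗ_tmul, h0, h1, add_zero, inner_self_eq_norm_sq_to_K, (H ι).norm_vec] at this
      simpa using this
  intro f
  have : f ∈ M := hM.mem_of_tendsto (lp.hasSum_single (by norm_num) f)
    (Filter.Eventually.of_forall fun s => M.sum_mem fun w _ => hs w _)
  exact this

/-- The free product representation `λ` of `B(H_ι)`: the bounded operator `V (x ⊗ 1) V⁻¹` on the free
product (see `freeRep_leftTensor`). -/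
def freeRep (ι : Fin 2) (x : H ι →L[ℂ] H ι) : FreeFock H →L[ℂ] FreeFock H :=
  ((leftTensor H ι).toContinuousLinearMap ∘L
    x.rTensor (supported H (Word.avoid ι))).extend (leftTensor H ι).toContinuousLinearMap

theorem freeRep_leftTensor (ι : Fin 2) (x : H ι →L[ℂ] H ι)
    (t : H ι ⊗[ℂ] supported H (Word.avoid ι)) :
    freeRep ι x (leftTensor H ι t) = leftTensor H ι (x.rTensor _ t) :=
  ContinuousLinearMap.extend_eq _ (e := (leftTensor H ι).toContinuousLinearMap)
    (denseRange_leftTensor ι) (leftTensor H ι).isometry.isUniformInducing t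

theorem exists_hasSum_compression {E : Type*} [NormedAddCommGroup E] [InnerProductSpace ℂ E]
    [CompleteSpace E] (V : ℕ → Submodule ℂ E) [∀ k, CompleteSpace (V k)]
    (hV : OrthogonalFamily ℂ (fun k => V k) fun k => (V k).subtypeₗᵢ) (A : E →L[ℂ] E) :
    ∃ S : E →L[ℂ] E, ∀ f : E, HasSum (fun k => ((V k).starProjection ∘L A ∘L
      (V k).starProjection - (V k).starProjection) f) (S f) := by
  have bessel : ∀ f : E, Summable fun k => ‖(V k).orthogonalProjectionOnto f‖ ^ 2 := by
    intro f
    refine summable_of_sum_le (c := ‖f‖ ^ 2) (fun _ => sq_nonneg _) fun s => ?_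
    have h1 := hV.norm_sum (fun k => (V k).orthogonalProjectionOnto f) s
    set y : E := ∑ k ∈ s, (V k).subtypeₗᵢ ((V k).orthogonalProjectionOnto f) with hy
    have h2 : inner ℂ y f = ((‖y‖ ^ 2 : ℝ) : ℂ) := by
      rw [h1, hy, sum_inner, Complex.ofReal_sum]
      refine Finset.sum_congr rfl fun k _ => ?_
      change inner ℂ ((V k).orthogonalProjectionOnto f : E) f = _
      rw [← Submodule.inner_orthogonalProjectionOnto_eq_of_mem_left,
        inner_self_eq_norm_sq_to_K]
      push_cast
      rfl
    have h3 : ‖y‖ ^ 2 ≤ ‖y‖ * ‖f‖ := by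
      have := norm_inner_le_norm (𝕜 := ℂ) y f
      rwa [h2, Complex.norm_real, Real.norm_of_nonneg (sq_nonneg _)] at this
    rw [← h1]
    nlinarith [norm_nonneg y, norm_nonneg f, sq_nonneg (‖y‖ - ‖f‖)]
  have hsum : ∀ f : E, Summable fun k => ((V k).starProjection ∘L A ∘L
      (V k).starProjection - (V k).starProjection) f := by
    intro f
    refine (hV.summable_iff_norm_sq_summable fun k =>
      (V k).orthogonalProjectionOnto (A ((V k).orthogonalProjectionOnto f : E)) -
        (V k).orthogonalProjectionOnto f).2 ?_
    refine Summable.of_nonneg_of_le (fun _ => sq_nonneg _) (fun k => ?_)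
      ((bessel f).mul_left ((‖A‖ + 1) ^ 2))
    rw [← mul_pow]
    refine pow_le_pow_left₀ (norm_nonneg _) ?_ 2
    refine (norm_sub_le _ _).trans ?_
    rw [add_mul, one_mul]
    refine add_le_add ?_ le_rfl
    exact ((V k).norm_orthogonalProjectionOnto_apply_le _).trans (A.le_opNorm _)
  have hT : Filter.Tendsto (fun (s : Finset ℕ) (f : E) => (∑ k ∈ s, ((V k).starProjection ∘L A ∘L
      (V k).starProjection - (V k).starProjection)) f) Filter.atTop
      (nhds fun f => ∑' k, ((V k).starProjection ∘L A ∘L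
      (V k).starProjection - (V k).starProjection) f) := by
    rw [tendsto_pi_nhds]
    intro f
    have := (hsum f).hasSum
    refine this.congr fun s => ?_
    rw [sum_apply]
  exact ⟨continuousLinearMapOfTendsto _ hT, fun f => (hsum f).hasSum⟩

/-- The other index, `ῑ`. -/
abbrev bar (ι : Fin 2) : Fin 2 := ι.rev

/-- Words of length `n` that do not start with `ι`. The corresponding subspace is `ℋ^{(n)}(ι)`; for
`n = 0` it is the vacuum line. -/
def levelWords (n : ℕ) (ι : Fin 2) : Set Word := {w | w.1.length = n ∧ w.1.head? ≠ some ι}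

/-- For `n ≥ 1`, the words that make up `ℋ^{(n-1)}(ι) ⊕ ℋ^{(n)}(ῑ)`. -/
def blockWords (ι : Fin 2) (n : ℕ) : Set Word := levelWords (n - 1) ι ∪ levelWords n (bar ι)

/-- The projection `P_ι(n)` of the free product onto `ℋ^{(n-1)}(ι) ⊕ ℋ^{(n)}(ῑ)`, for `n ≥ 1`. -/
def blockProj (H : Fin 2 → PointedHilbertSpace.{u}) (ι : Fin 2) (n : ℕ) :
    FreeFock H →L[ℂ] FreeFock H := (supported H (blockWords ι n)).starProjection

/-- `X_ι(j) = P_ι(j) X_ι P_ι(j)`, where `X_ι = λ(x_ι)`. -/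
def blockX (x : (i : Fin 2) → H i →L[ℂ] H i) (ι : Fin 2) (j : ℕ) : FreeFock H →L[ℂ] FreeFock H :=
  blockProj H ι j ∘L freeRep ι (x ι) ∘L blockProj H ι j

/-- `X_ι(j) - P_ι(j)`. -/
def blockSub (x : (i : Fin 2) → H i →L[ℂ] H i) (ι : Fin 2) (j : ℕ) : FreeFock H →L[ℂ] FreeFock H :=
  blockX x ι j - blockProj H ι j

theorem supported_orthogonal {S T : Set Word} (hST : Disjoint S T) (f : supported H S)
    (g : supported H T) : inner ℂ (f : FreeFock H) (g : FreeFock H) = 0 := by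
  rw [lp.inner_eq_tsum, ← tsum_zero (α := ℂ) (β := Word)]
  refine tsum_congr fun w => ?_
  by_cases hw : w ∈ S
  · rw [g.2 w (Set.disjoint_left.1 hST hw), inner_zero_right]
  · rw [f.2 w hw, inner_zero_left]

theorem orthogonalFamily_blocks (ι : Fin 2) (m : ℕ) :
    OrthogonalFamily ℂ (fun k => supported H (blockWords ι (m + 2 * k)))
      fun k => (supported H (blockWords ι (m + 2 * k))).subtypeₗᵢ := by
  intro k l hkl f g
  refine supported_orthogonal (Set.disjoint_left.2 fun w hk hl => ?_) f g
  simp only [blockWords, levelWords, Set.mem_union, Set.mem_ofPred_eq] at hk hl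
  omega

theorem exists_hasSum_blockSub (x : (i : Fin 2) → H i →L[ℂ] H i) (ι : Fin 2) (m : ℕ) :
    ∃ S : FreeFock H →L[ℂ] FreeFock H, ∀ f, HasSum (fun k => blockSub x ι (m + 2 * k) f) (S f) :=
  exists_hasSum_compression _ (orthogonalFamily_blocks ι m) (freeRep ι (x ι))

/-- The series `∑_{j ∈ J(m)} (X_ι(j) - P_ι(j))`, `J(m) = {m, m + 2, m + 4, …}`, as a bounded operator on
the free product; it converges in the strong operator topology (`hasSum_series`). -/
def series (x : (i : Fin 2) → H i →L[ℂ] H i) (ι : Fin 2) (m : ℕ) : FreeFock H →L[ℂ] FreeFock H :=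
  (exists_hasSum_blockSub x ι m).choose

theorem hasSum_series (x : (i : Fin 2) → H i →L[ℂ] H i) (ι : Fin 2) (m : ℕ) (f : FreeFock H) :
    HasSum (fun k => blockSub x ι (m + 2 * k) f) (series x ι m f) :=
  (exists_hasSum_blockSub x ι m).choose_spec f

variable (H) in
/-- The s-free product `K_ι = ⨁_{n odd} (ℋ^{(n-1)}(ι) ⊕ ℋ^{(n)}(ῑ))`, a closed subspace of the free
product. -/
abbrev sFreeFock (ι : Fin 2) : Submodule ℂ (FreeFock H) :=
  supported H (⋃ n : {n : ℕ // Odd n}, blockWords ι n)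

variable (H) in
/-- The vacuum vector `ξ`. -/
def vacuum : FreeFock H :=
  lp.single 2 (⟨[], List.isChain_nil⟩ : Word) (EuclideanSpace.single PUnit.unit (1 : ℂ))

theorem vacuum_mem (ι : Fin 2) : vacuum H ∈ sFreeFock H ι :=
  single_mem_supported (by
    refine Set.mem_iUnion.2 ⟨⟨1, odd_one⟩, Or.inl ⟨rfl, by simp⟩⟩) _

variable (H) in
/-- The vacuum vector as a vector of `K_ι`. -/
def vacuumK (ι : Fin 2) : sFreeFock H ι := ⟨vacuum H, vacuum_mem ι⟩

/-- The operator `R_ι(m) = 1 + ∑_{j ∈ J(m)} (X_ι(j) - P_ι(j))` on `K_κ`. In use, `κ = ι` for odd `m` and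
`κ = ῑ` for even `m`; then the summands leave `K_κ` invariant, and composing with the inclusion of `K_κ`
and the orthogonal projection onto it is restricting them to `K_κ`. -/
def opR (x : (i : Fin 2) → H i →L[ℂ] H i) (κ ι : Fin 2) (m : ℕ) :
    sFreeFock H κ →L[ℂ] sFreeFock H κ :=
  1 + (sFreeFock H κ).orthogonalProjectionOnto ∘L series x ι m ∘L (sFreeFock H κ).subtypeL

/-- `R_ι^{odd} = R_ι(1)`, an operator on `K_ι`. -/
def oddR (x : (i : Fin 2) → H i →L[ℂ] H i) (ι : Fin 2) : sFreeFock H ι →L[ℂ] sFreeFock H ι :=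
  opR x ι ι 1

/-- `R_ῑ^{even} = R_ῑ(2)`, an operator on `K_ι`. -/
def evenBarR (x : (i : Fin 2) → H i →L[ℂ] H i) (ι : Fin 2) :
    sFreeFock H ι →L[ℂ] sFreeFock H ι :=
  opR x ι (bar ι) 2

variable (H) in
/-- `H⁰_ι` as a subspace of the free product: the summand of the one-letter word `ι`. -/
def letterSpace (ι : Fin 2) : Submodule ℂ (FreeFock H) := supported H {w | w.1 = [ι]}

variable (H) in
/-- The projection `P_ξ` onto the vacuum line, as an operator on `K_ι`. -/
def vacuumProj (ι : Fin 2) : sFreeFock H ι →L[ℂ] sFreeFock H ι :=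
  (ℂ ∙ vacuumK H ι).starProjection

/-- The vector functional `a ↦ ⟨a v, v⟩` (Mathlib inner products are linear in the second
variable). -/
def vectorState {E : Type*} [NormedAddCommGroup E] [InnerProductSpace ℂ E] (v : E) :
    (E →L[ℂ] E) →ₗ[ℂ] ℂ where
  toFun a := inner ℂ v (a v)
  map_add' a b := by rw [add_apply, inner_add_right]
  map_smul' c a := by rw [smul_apply, inner_smul_right]; rfl

/-- The pair `(A₁, A₂)`, with `e` the internal unit of `A₂`, is free with subordination (s-free) with
respect to `(φ, ψ)`. In the alternating products, the letter `(0, a)` stands for an element `a` of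
`A₁ ∩ ker φ` and `(1, a)` for an element of `A₂ ∩ ker ψ`. -/
structure IsSFree {A : Type*} [Ring A] [Algebra ℂ A] (φ ψ : A →ₗ[ℂ] ℂ) (A₁ : Subalgebra ℂ A)
    (A₂ : NonUnitalSubalgebra ℂ A) (e : A) : Prop where
  phi_one : φ 1 = 1
  psi_one : ψ 1 = 1
  unit_mem : e ∈ A₂
  unit_mul : ∀ b ∈ A₂, e * b = b
  mul_unit : ∀ b ∈ A₂, b * e = b
  psi_unit : ψ e = 1
  alternating : ∀ l : List (Fin 2 × A), l ≠ [] → l.IsChain (fun p q => p.1 ≠ q.1) →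
    (∀ p ∈ l, (p.1 = 0 ∧ p.2 ∈ A₁ ∧ φ p.2 = 0) ∨ (p.1 = 1 ∧ p.2 ∈ A₂ ∧ ψ p.2 = 0)) →
    φ (l.map Prod.snd).prod = 0
  insertion : ∀ w₁ ∈ Algebra.adjoin ℂ ((A₁ : Set A) ∪ (A₂ : Set A)),
    ∀ w₂ ∈ Algebra.adjoin ℂ ((A₁ : Set A) ∪ (A₂ : Set A)),
    φ (w₁ * e * w₂) = φ (w₁ * w₂) - φ w₁ * φ w₂

/-- The pair of random variables `(a, b)` is s-free with respect to `(φ, ψ)`, with internal unit `e`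
of the second variable: `(alg(1, a), alg(e, b))` is s-free. -/
def IsSFreePairWithUnit {A : Type*} [Ring A] [Algebra ℂ A] (φ ψ : A →ₗ[ℂ] ℂ) (a b e : A) : Prop :=
  IsSFree φ ψ (Algebra.adjoin ℂ {a}) (NonUnitalAlgebra.adjoin ℂ {e, b}) e

/-- The pair of random variables `(a, b)` is s-free with respect to `(φ, ψ)`. -/
def IsSFreePair {A : Type*} [Ring A] [Algebra ℂ A] (φ ψ : A →ₗ[ℂ] ℂ) (a b : A) : Prop :=
  ∃ e : A, IsSFreePairWithUnit φ ψ a b e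

end

end FreeProd

open FreeProd

/-! Cut `K_ι` into its even words, which do not start with `ι`, and its odd words, which do. The
isometry `V_ι` identifies `H_ι ⊗ (even words)` with a subspace of `K_ι` on which `R_ι^odd - 1` acts
as `(a_ι - 1) ⊗ 1`, and `V_ῑ` identifies `H_ῑ ⊗ (odd words)` with one on which `R_ῑ^even - 1` acts
as `(a_ῑ - 1) ⊗ 1`. The states `φ` and `ψ` evaluate an ampliation `T ⊗ 1` at `⟨T ξ_ι, ξ_ι⟩` and
`⟨T ξ_ῑ, ξ_ῑ⟩`, so a centred `T ⊗ 1` puts one more letter in front of each word: centred elements of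
the first algebra carry even words to odd words, those of the second carry odd words to even words.
The second algebra moreover lies in the corner of `B(K_ι)` orthogonal to `ξ`. Hence an alternating
product of centred elements maps `ξ` to a vector orthogonal to `ξ`. -/

namespace FreeProd

open scoped TensorProduct

noncomputable section

theorem smul_mem_of_isChain {I M X : Type*} [Monoid M] [MulAction M X] {S : I → Set X} {v : X}
    (hv : ∀ i, v ∈ S i) {l : List (I × M)} (hl : l.IsChain fun p q => p.1 ≠ q.1)
    (hS : ∀ p ∈ l, ∀ j ≠ p.1, Set.MapsTo (p.2 • ·) (S p.1) (S j)) {i : I}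
    (hi : ∀ p ∈ l.head?, p.1 ≠ i) : (l.map Prod.snd).prod • v ∈ S i := by
  induction l generalizing i with
  | nil => simpa using hv i
  | cons p l ih =>
    obtain ⟨hpl, hl⟩ := List.isChain_cons.1 hl
    rw [List.map_cons, List.prod_cons, mul_smul]
    exact hS p List.mem_cons_self i (hi p rfl).symm <|
      ih hl (fun q hq => hS q (List.mem_cons_of_mem _ hq)) fun q hq => (hpl q hq).symm

section VectorState

variable {E : Type*} [NormedAddCommGroup E] [InnerProductSpace ℂ E] {v : E}

theorem vectorState_apply (v : E) (a : E →L[ℂ] E) : vectorState v a = inner ℂ v (a v) := rfl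

theorem vectorState_one (hv : ‖v‖ = 1) : vectorState v 1 = 1 := by
  rw [vectorState_apply, one_apply_eq_self, inner_self_eq_norm_sq_to_K, hv]
  simp

theorem vectorState_mul_one_sub_starProjection_mul (hv : ‖v‖ = 1) (a b : E →L[ℂ] E) :
    vectorState v (a * (1 - (ℂ ∙ v).starProjection) * b) =
      vectorState v (a * b) - vectorState v a * vectorState v b := by
  simp only [vectorState_apply, mul_apply_eq_comp, sub_apply, map_sub, one_apply_eq_self,
    Submodule.starProjection_unit_singleton ℂ hv, map_smul, inner_sub_right, inner_smul_right,
    mul_comm (inner ℂ v (a v))]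

/-- The corner `(1 - P) B(E) (1 - P)` of `B(E)`, where `P` is the projection onto `ℂ v`: the
operators that annihilate `v` and have range orthogonal to `v`. -/
def corner (v : E) : NonUnitalSubalgebra ℂ (E →L[ℂ] E) where
  carrier := {b | b v = 0 ∧ ∀ k, inner ℂ v (b k) = 0}
  add_mem' := fun ⟨hb, hb'⟩ ⟨hc, hc'⟩ =>
    ⟨by rw [add_apply, hb, hc, add_zero], fun k => by
      rw [add_apply, inner_add_right, hb', hc', add_zero]⟩
  zero_mem' := ⟨rfl, fun _ => inner_zero_right v⟩
  mul_mem' := fun {b _} ⟨_, hb⟩ ⟨hc, _⟩ =>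
    ⟨by rw [mul_apply_eq_comp, hc, map_zero], fun k => hb _⟩
  smul_mem' c _ := fun ⟨hb, hb'⟩ =>
    ⟨by rw [smul_apply, hb, smul_zero], fun k => by
      rw [smul_apply, inner_smul_right, hb', mul_zero]⟩

theorem starProjection_apply_eq_zero {k : E} (hk : inner ℂ v k = 0) :
    (ℂ ∙ v).starProjection k = 0 :=
  (Submodule.starProjection_apply_eq_zero_iff _).2
    (Submodule.mem_orthogonal_singleton_iff_inner_right.2 hk)

theorem one_sub_starProjection_mem_corner (v : E) : 1 - (ℂ ∙ v).starProjection ∈ corner v := by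
  refine ⟨?_, fun k => ?_⟩ <;> rw [sub_apply, one_apply_eq_self]
  · rw [Submodule.starProjection_eq_self_iff.2 (Submodule.mem_span_singleton_self v), sub_self]
  · exact Submodule.mem_orthogonal_singleton_iff_inner_right.1
      ((ℂ ∙ v).sub_starProjection_mem_orthogonal k)

theorem one_sub_starProjection_mul_of_mem_corner {b : E →L[ℂ] E} (hb : b ∈ corner v) :
    (1 - (ℂ ∙ v).starProjection) * b = b := by
  ext1 k
  rw [mul_apply_eq_comp, sub_apply, one_apply_eq_self, starProjection_apply_eq_zero (hb.2 k),
    sub_zero]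

theorem mul_one_sub_starProjection_of_mem_corner {b : E →L[ℂ] E} (hb : b ∈ corner v) :
    b * (1 - (ℂ ∙ v).starProjection) = b := by
  ext1 k
  obtain ⟨c, hc⟩ := Submodule.mem_span_singleton.1 ((ℂ ∙ v).starProjection_apply_mem k)
  rw [mul_apply_eq_comp, sub_apply, one_apply_eq_self, map_sub, ← hc, map_smul, hb.1, smul_zero,
    sub_zero]

variable {ζ : E} {A₁ : Subalgebra ℂ (E →L[ℂ] E)} {A₂ : NonUnitalSubalgebra ℂ (E →L[ℂ] E)}
  {W₁ W₂ : Submodule ℂ E}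

theorem vectorState_prod_eq_zero (hA₂ : A₂ ≤ corner v) (hvW₁ : v ∈ W₁)
    (hvW₂ : ∀ k ∈ W₂, inner ℂ v k = 0)
    (hA₁ : ∀ a ∈ A₁, vectorState v a = 0 → Set.MapsTo a W₁ W₂)
    (hA₂' : ∀ b ∈ A₂, vectorState ζ b = 0 → Set.MapsTo b W₂ W₁)
    {l : List (Fin 2 × (E →L[ℂ] E))} (hne : l ≠ []) (hl : l.IsChain fun p q => p.1 ≠ q.1)
    (hmem : ∀ p ∈ l, (p.1 = 0 ∧ p.2 ∈ A₁ ∧ vectorState v p.2 = 0) ∨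
      (p.1 = 1 ∧ p.2 ∈ A₂ ∧ vectorState ζ p.2 = 0)) :
    vectorState v (l.map Prod.snd).prod = 0 := by
  obtain ⟨p, l, rfl⟩ := List.exists_cons_of_ne_nil hne
  let S : Fin 2 → Set E := ![W₁, insert v W₂]
  have mapsTo : ∀ q ∈ p :: l, ∀ j ≠ q.1, Set.MapsTo q.2 (S q.1) (S j) := by
    rintro ⟨i, a⟩ hq j (hj : j ≠ i)
    obtain ⟨rfl, ha, hφ⟩ | ⟨rfl, hb, hψ⟩ := hmem _ hq
    · obtain rfl : j = 1 := by omega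
      exact fun k hk => Or.inr (hA₁ a ha hφ hk)
    · obtain rfl : j = 0 := by omega
      rintro k (rfl | hk)
      · exact (hA₂ hb).1.symm ▸ W₁.zero_mem
      · exact hA₂' a hb hψ hk
  have tail_mem : (l.map Prod.snd).prod v ∈ S p.1 := by
    obtain ⟨hpl, hl⟩ := List.isChain_cons.1 hl
    refine smul_mem_of_isChain (Fin.forall_fin_two.2 ⟨hvW₁, Set.mem_insert v _⟩) hl
      (fun q hq => mapsTo q (List.mem_cons_of_mem p hq)) fun q hq => (hpl q hq).symm
  rw [List.map_cons, List.prod_cons, vectorState_apply, mul_apply_eq_comp]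
  obtain ⟨hp, ha, hφ⟩ | ⟨-, hb, -⟩ := hmem p List.mem_cons_self
  · rw [hp] at tail_mem
    exact hvW₂ _ (hA₁ _ ha hφ tail_mem)
  · exact (hA₂ hb).2 _

theorem isSFree_vectorState (hv : ‖v‖ = 1) (hζ : ‖ζ‖ = 1) (hvζ : inner ℂ v ζ = 0)
    (unit_mem : 1 - (ℂ ∙ v).starProjection ∈ A₂) (hA₂ : A₂ ≤ corner v) (hvW₁ : v ∈ W₁)
    (hvW₂ : ∀ k ∈ W₂, inner ℂ v k = 0)
    (hA₁ : ∀ a ∈ A₁, vectorState v a = 0 → Set.MapsTo a W₁ W₂)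
    (hA₂' : ∀ b ∈ A₂, vectorState ζ b = 0 → Set.MapsTo b W₂ W₁) :
    IsSFree (vectorState v) (vectorState ζ) A₁ A₂ (1 - (ℂ ∙ v).starProjection) where
  phi_one := vectorState_one hv
  psi_one := vectorState_one hζ
  unit_mem := unit_mem
  unit_mul _ hb := one_sub_starProjection_mul_of_mem_corner (hA₂ hb)
  mul_unit _ hb := mul_one_sub_starProjection_of_mem_corner (hA₂ hb)
  psi_unit := by
    rw [map_sub, vectorState_one hζ, vectorState_apply, starProjection_apply_eq_zero hvζ,
      inner_zero_right, sub_zero]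
  alternating _ := vectorState_prod_eq_zero hA₂ hvW₁ hvW₂ hA₁ hA₂'
  insertion w₁ _ w₂ _ := vectorState_mul_one_sub_starProjection_mul hv w₁ w₂

end VectorState

section Ampliation

variable {L F E : Type*} [NormedAddCommGroup L] [InnerProductSpace ℂ L] [NormedAddCommGroup F]
  [InnerProductSpace ℂ F] [NormedAddCommGroup E] [InnerProductSpace ℂ E]

/-- The algebra of the operators `D` on `E` that act as `T ⊗ 1` on the image of an isometry
`V : L ⊗ F → E` defined on the algebraic tensor product, for some linear operator `T` on `L`. On the
complement of the image they are arbitrary. -/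
def ampliations (V : L ⊗[ℂ] F →ₗᵢ[ℂ] E) : Subalgebra ℂ (E →L[ℂ] E) where
  carrier := {D | ∃ T : Module.End ℂ L, ∀ h f, D (V (h ⊗ₜ f)) = V (T h ⊗ₜ f)}
  mul_mem' := fun ⟨T, hT⟩ ⟨T', hT'⟩ => ⟨T * T', fun h f => by
    rw [mul_apply_eq_comp, hT', hT, Module.End.mul_apply]⟩
  add_mem' := fun ⟨T, hT⟩ ⟨T', hT'⟩ => ⟨T + T', fun h f => by
    rw [add_apply, hT, hT', LinearMap.add_apply, TensorProduct.add_tmul, map_add]⟩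
  algebraMap_mem' c := ⟨algebraMap ℂ _ c, fun h f => by
    rw [Algebra.algebraMap_eq_smul_one, smul_apply, one_apply_eq_self,
      Module.algebraMap_end_apply, ← TensorProduct.smul_tmul', map_smul]⟩

theorem exists_mem_orthogonal_of_mem_ampliations {V : L ⊗[ℂ] F →ₗᵢ[ℂ] E} {D : E →L[ℂ] E}
    (hD : D ∈ ampliations V) {ξ : L} {f₀ : F} (hf₀ : f₀ ≠ 0)
    (h : vectorState (V (ξ ⊗ₜ f₀)) D = 0) :
    ∃ η ∈ (ℂ ∙ ξ)ᗮ, ∀ f, D (V (ξ ⊗ₜ f)) = V (η ⊗ₜ f) := by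
  obtain ⟨T, hT⟩ := hD
  refine ⟨T ξ, Submodule.mem_orthogonal_singleton_iff_inner_right.2 ?_, hT ξ⟩
  rw [vectorState_apply, hT, LinearIsometry.inner_map_map, TensorProduct.inner_tmul] at h
  exact (mul_eq_zero.1 h).resolve_right (inner_self_ne_zero.2 hf₀)

end Ampliation

section Words

variable {j ι : Fin 2} {m : ℕ}

/-- The words that do not start with `j` and whose extension by the letter `j` has length in
`{m, m + 2, m + 4, …}`: `V (h ⊗ f)` is in the range of the projections of the series
`∑ (X_j(n) - P_j(n))`, `n = m, m + 2, …`, when `f` is a sum of tensors attached to these words. -/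
def tailWords (j : Fin 2) (m : ℕ) : Set Word :=
  {w | w ∈ Word.avoid j ∧ ∃ k, w.1.length + 1 = m + 2 * k}

/-- The words that make up the ranges of the projections `P_j(m), P_j(m + 2), P_j(m + 4), …`. -/
def seriesWords (j : Fin 2) (m : ℕ) : Set Word := ⋃ k, blockWords j (m + 2 * k)

theorem mem_seriesWords {w : Word} : w ∈ seriesWords j m ↔
    ∃ k, w ∈ levelWords (m + 2 * k - 1) j ∨ w ∈ levelWords (m + 2 * k) (bar j) :=
  Set.mem_iUnion

theorem seriesWords_one : seriesWords ι 1 = ⋃ n : {n : ℕ // Odd n}, blockWords ι n := by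
  ext w
  simp only [seriesWords, Set.mem_iUnion, Subtype.exists, Odd, exists_prop, add_comm 1]
  exact ⟨fun ⟨k, hk⟩ => ⟨_, ⟨k, rfl⟩, hk⟩, fun ⟨_, ⟨k, rfl⟩, hk⟩ => ⟨k, hk⟩⟩

theorem seriesWords_bar_succ_subset : seriesWords (bar j) (m + 1) ⊆ seriesWords j m := by
  intro w hw
  obtain ⟨k, ⟨h, hj⟩ | ⟨h, hj⟩⟩ := mem_seriesWords.1 hw
  · exact mem_seriesWords.2 ⟨k, Or.inr ⟨by omega, hj⟩⟩
  · exact mem_seriesWords.2 ⟨k + 1, Or.inl ⟨by omega, by rwa [bar, Fin.rev_rev] at hj⟩⟩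

theorem nil_notMem_seriesWords (hm : 2 ≤ m) : ⟨[], List.isChain_nil⟩ ∉ seriesWords j m := by
  intro h
  obtain ⟨k, ⟨h, -⟩ | ⟨h, -⟩⟩ := mem_seriesWords.1 h <;> rw [List.length_nil] at h <;> omega

theorem tailWords_subset_avoid : tailWords j m ⊆ Word.avoid j := fun _ h => h.1

theorem tailWords_subset_seriesWords : tailWords j m ⊆ seriesWords j m := fun _ ⟨hj, k, hk⟩ =>
  mem_seriesWords.2 ⟨k, Or.inl ⟨by omega, hj⟩⟩

theorem tailWords_add_two_subset : tailWords j (m + 2) ⊆ tailWords j m := fun _ ⟨hj, k, hk⟩ =>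
  ⟨hj, k + 1, by omega⟩

theorem seriesWords_one_diff_avoid_subset :
    seriesWords ι 1 \ Word.avoid ι ⊆ tailWords (bar ι) 2 := by
  rintro w ⟨hw, hι⟩
  obtain ⟨k, h | ⟨h, hj⟩⟩ := mem_seriesWords.1 hw
  · exact absurd h.2 hι
  · exact ⟨hj, k, by omega⟩

theorem cons_mem_levelWords {n : ℕ} (w : Word.avoid j) (hw : w.1 ∈ levelWords n j) :
    Word.cons j w ∈ levelWords (n + 1) (bar j) :=
  ⟨congrArg (· + 1) hw.1, by
    fin_cases j <;> simp [bar]⟩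

theorem cons_mem_tailWords (w : Word.avoid j) (hw : w.1 ∈ tailWords j m) :
    Word.cons j w ∈ tailWords (bar j) (m + 1) := by
  obtain ⟨-, k, hk⟩ := hw
  obtain ⟨h, hj⟩ := cons_mem_levelWords w ⟨rfl, w.2⟩
  exact ⟨hj, k, by omega⟩

theorem cons_mem_seriesWords (w : Word.avoid j) (hw : w.1 ∈ tailWords j m) :
    Word.cons j w ∈ seriesWords j m :=
  seriesWords_bar_succ_subset (tailWords_subset_seriesWords (cons_mem_tailWords w hw))

theorem mem_tailWords_iff {w : Word} :
    w ∈ tailWords j m ↔ ∃ k n, w ∈ levelWords n j ∧ n + 1 = m + 2 * k :=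
  ⟨fun ⟨hj, k, hk⟩ => ⟨k, _, ⟨rfl, hj⟩, hk⟩, fun ⟨k, _, ⟨h, hj⟩, hk⟩ => ⟨hj, k, h ▸ hk⟩⟩

end Words

section Fock

variable {H : Fin 2 → PointedHilbertSpace.{u}} {S T : Set Word} {j : Fin 2} {m : ℕ}

theorem supported_mono (h : S ⊆ T) : supported H S ≤ supported H T :=
  fun _ hf w hw => hf w fun hs => hw (h hs)

theorem vacuum_mem_supported (hS : ⟨[], List.isChain_nil⟩ ∈ S) : vacuum H ∈ supported H S :=
  single_mem_supported hS _

theorem inner_vacuum {f : FreeFock H} (hS : ⟨[], List.isChain_nil⟩ ∉ S)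
    (hf : f ∈ supported H S) : inner ℂ (vacuum H) f = 0 :=
  supported_orthogonal (Set.disjoint_singleton_left.2 hS) ⟨_, vacuum_mem_supported rfl⟩ ⟨f, hf⟩

theorem norm_vacuum : ‖vacuum H‖ = 1 := by
  refine (lp.norm_single (E := fun w : Word => wordSpace H w.1) (p := 2) (by norm_num) _ _).trans ?_
  exact (PiLp.norm_single (p := 2) (β := fun _ : PUnit.{u + 1} => ℂ) _ _).trans (by simp)

theorem supported_clm_ext {G : Type*} [AddCommMonoid G] [Module ℂ G] [TopologicalSpace G]
    [T2Space G] {A B : supported H S →L[ℂ] G} (h : ∀ w ∈ S, ∀ f : supported H S,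
      (f : FreeFock H) ∈ supported H {w} → A f = B f) : A = B := by
  let P : FreeFock H →L[ℂ] supported H S := (supported H S).orthogonalProjectionOnto
  have comp_P : A ∘L P = B ∘L P := by
    refine lp.ext_continuousLinearMap (by norm_num) fun w => ?_
    ext1 a
    change A (P (lp.single 2 w a)) = B (P (lp.single 2 w a))
    by_cases hw : w ∈ S
    · have P_single : P (lp.single 2 w a) = ⟨_, single_mem_supported hw a⟩ :=
        Submodule.orthogonalProjectionOnto_mem_subspace_eq_self ⟨_, single_mem_supported hw a⟩
      rw [P_single]
      exact h w hw _ (single_mem_supported (Set.mem_singleton w) a)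
    · have P_single : P (lp.single 2 w a) = 0 :=
        Submodule.orthogonalProjectionOnto_eq_zero_iff.2 fun f hf =>
          supported_orthogonal (Set.disjoint_singleton_right.2 hw) ⟨f, hf⟩
            ⟨_, single_mem_supported (Set.mem_singleton w) a⟩
      rw [P_single, map_zero, map_zero]
  ext1 f
  simpa [P] using congrArg (· (f : FreeFock H)) comp_P

theorem create_mem_supported (h : (H j).compl) {f : FreeFock H} (hf : f ∈ supported H S)
    (hT : ∀ w : Word.avoid j, w.1 ∈ S → Word.cons j w ∈ T) : create h f ∈ supported H T := by
  intro w hw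
  by_cases hr : w ∈ Set.range (Word.cons j)
  · obtain ⟨v, rfl⟩ := hr
    rw [create_cons, hf v.1 fun hv => hw (hT v hv), TensorProduct.tmul_zero, map_zero]
  · exact create_eq_zero h f w hr

theorem leftTensor_mem_supported (h : H j) {f : supported H (Word.avoid j)}
    (hf : (f : FreeFock H) ∈ supported H S) (hS : S ⊆ T)
    (hT : ∀ w : Word.avoid j, w.1 ∈ S → Word.cons j w ∈ T) :
    leftTensor H j (h ⊗ₜ[ℂ] f) ∈ supported H T := by
  rw [leftTensor_tmul]
  exact add_mem (Submodule.smul_mem _ _ (supported_mono hS hf)) (create_mem_supported _ hf hT)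

theorem leftTensor_mem_supported_blockWords {n : ℕ} (h : H j) {f : supported H (Word.avoid j)}
    (hf : (f : FreeFock H) ∈ supported H (levelWords n j)) :
    leftTensor H j (h ⊗ₜ[ℂ] f) ∈ supported H (blockWords j (n + 1)) :=
  leftTensor_mem_supported h hf Set.subset_union_left fun w hw => Or.inr (cons_mem_levelWords w hw)

theorem leftTensor_vec_tmul (f : supported H (Word.avoid j)) :
    leftTensor H j ((H j).vec ⊗ₜ[ℂ] f) = f := by
  have proj_vec : (H j).compl.orthogonalProjectionOnto (H j).vec = 0 :=
    Submodule.orthogonalProjectionOnto_orthogonal_apply_eq_zero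
      (Submodule.mem_span_singleton_self _)
  have create_zero : create (0 : (H j).compl) (f : FreeFock H) = 0 :=
    (createₗ (H := H) j).map_zero₂ f
  rw [leftTensor_tmul, proj_vec, create_zero, add_zero, inner_self_eq_norm_sq_to_K,
    (H j).norm_vec]
  simp

theorem leftTensor_tmul_of_mem_compl {η : H j} (hη : η ∈ (H j).compl)
    (f : supported H (Word.avoid j)) :
    leftTensor H j (η ⊗ₜ[ℂ] f) = create ⟨η, hη⟩ f := by
  rw [leftTensor_tmul, Submodule.mem_orthogonal_singleton_iff_inner_right.1 hη, zero_smul, zero_add,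
    Submodule.orthogonalProjectionOnto_mem_subspace_eq_self ⟨η, hη⟩]

end Fock

section Series

variable {H : Fin 2 → PointedHilbertSpace.{u}} {S : Set Word} {j : Fin 2} {m : ℕ}
  (x : (i : Fin 2) → H i →L[ℂ] H i)

theorem blockSub_leftTensor_tmul {n : ℕ} (h : H j) {f : supported H (Word.avoid j)}
    (hf : (f : FreeFock H) ∈ supported H (levelWords n j)) :
    blockSub x j (n + 1) (leftTensor H j (h ⊗ₜ[ℂ] f)) = leftTensor H j ((x j h - h) ⊗ₜ[ℂ] f) := by
  have blockProj_eq (h' : H j) :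
      blockProj H j (n + 1) (leftTensor H j (h' ⊗ₜ[ℂ] f)) = leftTensor H j (h' ⊗ₜ[ℂ] f) :=
    Submodule.starProjection_eq_self_iff.2 (leftTensor_mem_supported_blockWords h' hf)
  have freeRep_eq :
      freeRep j (x j) (leftTensor H j (h ⊗ₜ[ℂ] f)) = leftTensor H j (x j h ⊗ₜ[ℂ] f) :=
    freeRep_leftTensor j (x j) _
  simp only [blockSub, blockX, sub_apply, ContinuousLinearMap.comp_apply, blockProj_eq,
    freeRep_eq, TensorProduct.sub_tmul, map_sub]

theorem blockSub_apply_eq_zero {n : ℕ} {f : FreeFock H}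
    (hf : f ∈ (supported H (blockWords j n))ᗮ) : blockSub x j n f = 0 := by
  have blockProj_eq : blockProj H j n f = 0 :=
    (Submodule.starProjection_apply_eq_zero_iff _).2 hf
  simp only [blockSub, blockX, sub_apply, ContinuousLinearMap.comp_apply, blockProj_eq, map_zero,
    sub_zero]

theorem series_apply_of_mem_block {k : ℕ} {f : FreeFock H}
    (hf : f ∈ supported H (blockWords j (m + 2 * k))) :
    series x j m f = blockSub x j (m + 2 * k) f :=
  (hasSum_series x j m f).unique <| hasSum_single k fun _ hl => blockSub_apply_eq_zero x <|
    ((orthogonalFamily_blocks j m).isOrtho hl.symm).le hf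

theorem series_apply_eq_zero {f : FreeFock H} (hS : Disjoint (seriesWords j m) S)
    (hf : f ∈ supported H S) : series x j m f = 0 := by
  refine (hasSum_series x j m f).unique (hasSum_zero.congr_fun fun k => ?_)
  refine blockSub_apply_eq_zero x fun g hg => supported_orthogonal ?_ ⟨g, hg⟩ ⟨f, hf⟩
  exact hS.mono_left (Set.subset_iUnion (fun k => blockWords j (m + 2 * k)) k)

theorem series_mem_supported (f : FreeFock H) :
    series x j m f ∈ supported H (seriesWords j m) :=
  (isClosed_supported _).mem_of_tendsto (hasSum_series x j m f) <|
    Filter.Eventually.of_forall fun _ => Submodule.sum_mem _ fun k _ =>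
      supported_mono (Set.subset_iUnion (fun k => blockWords j (m + 2 * k)) k) <|
        Submodule.sub_mem _ (Submodule.starProjection_apply_mem _ _)
          (Submodule.starProjection_apply_mem _ _)

variable (H j m) in
/-- The restriction of the isometry `V = leftTensor H j` to `H_j ⊗ F`, where `F` is the sum of the
tensor products attached to `tailWords j m`. -/
def tailTensor : H j ⊗[ℂ] supported H (tailWords j m) →ₗᵢ[ℂ] FreeFock H :=
  (leftTensor H j).comp <| LinearIsometry.lTensor (H j)
    ⟨Submodule.inclusion (supported_mono tailWords_subset_avoid), fun _ => rfl⟩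

theorem tailTensor_mem_supported (t : H j ⊗[ℂ] supported H (tailWords j m)) :
    tailTensor H j m t ∈ supported H (seriesWords j m) := by
  induction t with
  | zero => rw [map_zero]; exact zero_mem _
  | add t t' ht ht' => rw [map_add]; exact add_mem ht ht'
  | tmul h f =>
    exact leftTensor_mem_supported h f.2 tailWords_subset_seriesWords cons_mem_seriesWords

theorem series_tailTensor_tmul (h : H j) (f : supported H (tailWords j m)) :
    series x j m (tailTensor H j m (h ⊗ₜ f)) = tailTensor H j m ((x j h - h) ⊗ₜ f) := by
  let V (h : H j) := (tailTensor H j m).toContinuousLinearMap ∘L TensorProduct.mkL ℂ _ _ h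
  suffices series x j m ∘L V h = V (x j h - h) from congrArg (· f) this
  refine supported_clm_ext fun w hw f hf => ?_
  obtain ⟨k, n, hwn, hn⟩ := mem_tailWords_iff.1 hw
  have hf' : (f : FreeFock H) ∈ supported H (levelWords n j) :=
    supported_mono (Set.singleton_subset_iff.2 hwn) hf
  let g := Submodule.inclusion (supported_mono tailWords_subset_avoid) f
  change series x j m (leftTensor H j (h ⊗ₜ g)) = leftTensor H j ((x j h - h) ⊗ₜ g)
  rw [series_apply_of_mem_block x (hn ▸ leftTensor_mem_supported_blockWords h hf'), ← hn]
  exact blockSub_leftTensor_tmul x h hf'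

end Series

section SFreeFock

variable {H : Fin 2 → PointedHilbertSpace.{u}} {κ j : Fin 2} {m : ℕ}

/-- `tailTensor H j m` as an isometry into a space `K_κ` containing its range. -/
def sFreeTensor (hK : supported H (seriesWords j m) ≤ sFreeFock H κ) :
    H j ⊗[ℂ] supported H (tailWords j m) →ₗᵢ[ℂ] sFreeFock H κ where
  toLinearMap := (tailTensor H j m).toLinearMap.codRestrict _
    fun t => hK (tailTensor_mem_supported t)
  norm_map' := (tailTensor H j m).norm_map

variable (H) in
/-- The vectors of `K_κ` in the sum of the tensor products attached to `tailWords j m`. -/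
def tailSpace (κ j : Fin 2) (m : ℕ) : Submodule ℂ (sFreeFock H κ) :=
  (supported H (tailWords j m)).submoduleOf (sFreeFock H κ)

variable {hK : supported H (seriesWords j m) ≤ sFreeFock H κ}

theorem mapsTo_of_mem_ampliations {D : sFreeFock H κ →L[ℂ] sFreeFock H κ}
    (hD : D ∈ ampliations (sFreeTensor hK)) {k₀ : sFreeFock H κ} (hk₀ : k₀ ∈ tailSpace H κ j m)
    (hne : k₀ ≠ 0) (h : vectorState k₀ D = 0) :
    Set.MapsTo D (tailSpace H κ j m) (tailSpace H κ (bar j) (m + 1)) := by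
  have sFreeTensor_vec_tmul (k : sFreeFock H κ) (hk : k ∈ tailSpace H κ j m) :
      sFreeTensor hK ((H j).vec ⊗ₜ ⟨k, hk⟩) = k :=
    Subtype.ext (leftTensor_vec_tmul _)
  have tail_ne : (⟨k₀, hk₀⟩ : supported H (tailWords j m)) ≠ 0 := fun h0 =>
    hne (Subtype.ext (congrArg Subtype.val h0 :))
  rw [← sFreeTensor_vec_tmul k₀ hk₀] at h
  obtain ⟨η, hη, hDη⟩ := exists_mem_orthogonal_of_mem_ampliations hD tail_ne h
  intro k hk
  let f : supported H (Word.avoid j) := ⟨k, supported_mono tailWords_subset_avoid hk⟩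
  have hDk := hDη ⟨k, hk⟩
  rw [sFreeTensor_vec_tmul k hk] at hDk
  rw [hDk]
  change leftTensor H j (η ⊗ₜ f) ∈ supported H (tailWords (bar j) (m + 1))
  rw [leftTensor_tmul_of_mem_compl hη]
  exact create_mem_supported _ hk cons_mem_tailWords

variable (x : (i : Fin 2) → H i →L[ℂ] H i)

theorem opR_sub_one_apply (hK : supported H (seriesWords j m) ≤ sFreeFock H κ)
    (k : sFreeFock H κ) :
    (((opR x κ j m - 1) k : sFreeFock H κ) : FreeFock H) = series x j m k := by
  rw [opR, add_sub_cancel_left]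
  exact Submodule.starProjection_eq_self_iff.2 (hK (series_mem_supported x _))

theorem opR_sub_one_mem_ampliations : opR x κ j m - 1 ∈ ampliations (sFreeTensor hK) :=
  ⟨x j - 1, fun h f => Subtype.ext <|
    (opR_sub_one_apply x hK _).trans (series_tailTensor_tmul x h f)⟩

theorem inner_vacuumK {S : Set Word} {k : sFreeFock H κ} (hS : ⟨[], List.isChain_nil⟩ ∉ S)
    (hk : (k : FreeFock H) ∈ supported H S) : inner ℂ (vacuumK H κ) k = 0 :=
  inner_vacuum hS hk

theorem opR_sub_one_mem_corner (hK : supported H (seriesWords j m) ≤ sFreeFock H κ)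
    (hm : 2 ≤ m) : opR x κ j m - 1 ∈ corner (vacuumK H κ) := by
  refine ⟨Subtype.ext ?_, fun k => inner_vacuumK (nil_notMem_seriesWords (j := j) hm) ?_⟩
  · rw [opR_sub_one_apply x hK]
    exact series_apply_eq_zero x (Set.disjoint_singleton_right.2 (nil_notMem_seriesWords hm))
      (vacuum_mem_supported (Set.mem_singleton _))
  · rw [opR_sub_one_apply x hK]
    exact series_mem_supported x _

theorem one_sub_vacuumProj_mem_ampliations (hm : 2 ≤ m) :
    1 - vacuumProj H κ ∈ ampliations (sFreeTensor hK) := by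
  refine ⟨1, fun h f => ?_⟩
  rw [sub_apply, vacuumProj, starProjection_apply_eq_zero
    (inner_vacuumK (nil_notMem_seriesWords hm) (tailTensor_mem_supported _)), sub_zero]
  rfl

variable (H κ) in
theorem supported_seriesWords_one_le : supported H (seriesWords κ 1) ≤ sFreeFock H κ :=
  seriesWords_one ▸ le_rfl

variable (H κ) in
theorem supported_seriesWords_bar_two_le :
    supported H (seriesWords (bar κ) 2) ≤ sFreeFock H κ :=
  (supported_mono seriesWords_bar_succ_subset).trans (supported_seriesWords_one_le H κ)

theorem adjoin_oddR_le :
    Algebra.adjoin ℂ {oddR x κ - 1} ≤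
      ampliations (sFreeTensor (supported_seriesWords_one_le H κ)) :=
  Algebra.adjoin_le (Set.singleton_subset_iff.2 (opR_sub_one_mem_ampliations x))

theorem adjoin_evenBarR_le_corner :
    NonUnitalAlgebra.adjoin ℂ {1 - vacuumProj H κ, evenBarR x κ - 1} ≤ corner (vacuumK H κ) :=
  NonUnitalAlgebra.adjoin_le (Set.pair_subset (one_sub_starProjection_mem_corner _)
    (opR_sub_one_mem_corner x (supported_seriesWords_bar_two_le H κ) le_rfl))

theorem adjoin_evenBarR_le_ampliations :
    NonUnitalAlgebra.adjoin ℂ {1 - vacuumProj H κ, evenBarR x κ - 1} ≤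
      (ampliations (sFreeTensor
        (supported_seriesWords_bar_two_le H κ))).toNonUnitalSubalgebra :=
  NonUnitalAlgebra.adjoin_le (Set.pair_subset (one_sub_vacuumProj_mem_ampliations le_rfl)
    (opR_sub_one_mem_ampliations x))

theorem norm_vacuumK : ‖vacuumK H κ‖ = 1 := norm_vacuum

theorem vacuumK_mem_tailSpace : vacuumK H κ ∈ tailSpace H κ κ 1 :=
  vacuum_mem_supported ⟨(Option.some_ne_none κ).symm, 0, rfl⟩

theorem inner_vacuumK_of_mem_tailSpace (hm : 2 ≤ m) {k : sFreeFock H κ}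
    (hk : k ∈ tailSpace H κ j m) : inner ℂ (vacuumK H κ) k = 0 :=
  inner_vacuumK (nil_notMem_seriesWords hm) (supported_mono tailWords_subset_seriesWords hk)

theorem tailSpace_bar_bar_le : tailSpace H κ (bar (bar j)) (m + 2) ≤ tailSpace H κ j m := by
  rw [bar, bar, Fin.rev_rev]
  exact Submodule.comap_mono (supported_mono tailWords_add_two_subset)

theorem letterSpace_le : letterSpace H j ≤ supported H (Word.avoid j)ᶜ :=
  supported_mono fun w (hw : w.1 = [j]) hj => hj (by rw [hw, List.head?_cons])

theorem mem_tailSpace_bar_two {k : sFreeFock H κ}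
    (hk : (k : FreeFock H) ∈ supported H (Word.avoid κ)ᶜ) : k ∈ tailSpace H κ (bar κ) 2 := by
  intro w hw
  by_cases hκ : w ∈ Word.avoid κ
  · exact hk w (not_not.2 hκ)
  · exact k.2 w fun h => hw (seriesWords_one_diff_avoid_subset ⟨seriesWords_one.symm ▸ h, hκ⟩)

end SFreeFock

end

end FreeProd

theorem proposition8p2_general (H : Fin 2 → PointedHilbertSpace.{u})
    (x : (i : Fin 2) → H i →L[ℂ] H i) (ι : Fin 2) (ζ : sFreeFock H ι)
    (hζ : (ζ : FreeFock H) ∈ supported H (Word.avoid ι)ᶜ) (hζ_norm : ‖ζ‖ = 1) :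
    IsSFreePairWithUnit (vectorState (vacuumK H ι)) (vectorState ζ)
      (oddR x ι - 1) (evenBarR x ι - 1) (1 - vacuumProj H ι) := by
  have hζ_tail : ζ ∈ tailSpace H ι (bar ι) 2 := mem_tailSpace_bar_two hζ
  have hζ_ne : ζ ≠ 0 := norm_ne_zero_iff.1 (hζ_norm ▸ one_ne_zero)
  have vacuumK_ne : vacuumK H ι ≠ 0 := norm_ne_zero_iff.1 (norm_vacuumK ▸ one_ne_zero)
  refine isSFree_vectorState (W₁ := tailSpace H ι ι 1) (W₂ := tailSpace H ι (bar ι) 2)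
    norm_vacuumK hζ_norm (inner_vacuumK_of_mem_tailSpace le_rfl hζ_tail)
    (NonUnitalAlgebra.subset_adjoin ℂ (Set.mem_insert _ _)) (adjoin_evenBarR_le_corner x)
    vacuumK_mem_tailSpace (fun k => inner_vacuumK_of_mem_tailSpace le_rfl)
    (fun a ha => ?odd) fun b hb hψ => ?even
  case odd =>
    exact mapsTo_of_mem_ampliations (adjoin_oddR_le x ha) vacuumK_mem_tailSpace vacuumK_ne
  case even =>
    exact (mapsTo_of_mem_ampliations (adjoin_evenBarR_le_ampliations x hb) hζ_tail hζ_ne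
      hψ).mono_right tailSpace_bar_bar_le

theorem proposition8p2 (H : Fin 2 → PointedHilbertSpace.{u})
    (x : (i : Fin 2) → H i →L[ℂ] H i) (ι : Fin 2)
    (ζ : sFreeFock H ι) (hζ : (ζ : FreeFock H) ∈ letterSpace H ι) (hζ_norm : ‖ζ‖ = 1) :
    IsSFreePair (vectorState (vacuumK H ι)) (vectorState ζ) (oddR x ι - 1) (evenBarR x ι - 1) ∧
    IsSFreePairWithUnit (vectorState (vacuumK H ι)) (vectorState ζ)
      (oddR x ι - 1) (evenBarR x ι - 1) (1 - vacuumProj H ι) := by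
  have h := proposition8p2_general H x ι ζ (letterSpace_le hζ) hζ_norm
  exact ⟨⟨_, h⟩, h⟩
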